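/- Let $R$ be a Noetherian local ring with maximal ideal $\mathfrak m$ and let $J$ be an ideal of $R$. Put $0:J^\infty=\bigcup_{m\ge 0}(0:J^m)$. Call a finite sequence $a_1,\dots,a_s$ ($s\ge 0$) of non-invertible elements of $R$ analytically independent if every homogeneous polynomial in $R[x_1,\dots,x_s]$ vanishing at $(a_1,\dots,a_s)$ has all its coefficients in $\mathfrak m$. Then the number of elements $s$ of analytically independent sequences $a_1,\dots,a_s$ in $J$ attains a maximum. If $J$ is not nilpotent, this maximum equals the Krull dimension $\dim R/(0:J^\infty)$. If $J$ is nilpotent, then $0:J^\infty=R$ and the maximum is $0$; that is, the formula holds with the dimension of the zero ring read as $0$. -/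

import Mathlib

/-- The saturation `0 : J^∞ = ⋃ m, (0 : J ^ m)` of the zero ideal with respect to `J`.
The ideals `0 : J ^ m` form an increasing chain, so their supremum is their union
(see `mem_zeroSaturation`). -/
def zeroSaturation {R : Type*} [CommRing R] (J : Ideal R) : Ideal R :=
  ⨆ m : ℕ, (⊥ : Ideal R).colon ((J ^ m : Ideal R) : Set R)

theorem mem_zeroSaturation {R : Type*} [CommRing R] (J : Ideal R) (r : R) :
    r ∈ zeroSaturation J ↔ ∃ m : ℕ, ∀ x ∈ J ^ m, r * x = 0 := by
  have hdir : Directed (· ≤ ·)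
      fun m : ℕ => (⊥ : Ideal R).colon ((J ^ m : Ideal R) : Set R) := by
    refine Monotone.directed_le fun m n hmn => ?_
    exact Submodule.colon_mono le_rfl (Ideal.pow_le_pow_right hmn)
  rw [zeroSaturation, Submodule.mem_iSup_of_directed _ hdir]
  simp [Submodule.mem_annihilator]

/-- A finite sequence `a` of non-invertible elements of a local ring is analytically independent
if every homogeneous polynomial vanishing at `a` has all its coefficients in the maximal ideal.
(Entries of such a sequence are automatically nonzero and pairwise distinct, as the polynomials
`X i` and `X i - X j` show.) -/
def AnalyticallyIndependent {R : Type*} [CommRing R] [IsLocalRing R] {s : ℕ}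
    (a : Fin s → R) : Prop :=
  (∀ i, a i ∈ IsLocalRing.maximalIdeal R) ∧
    ∀ (d : ℕ) (f : MvPolynomial (Fin s) R), f.IsHomogeneous d → MvPolynomial.eval a f = 0 →
      ∀ e : Fin s →₀ ℕ, f.coeff e ∈ IsLocalRing.maximalIdeal R

/-! Lower bound: some minimal prime `p` of `0 : J^∞` has the same quotient dimension, and `J` is not
contained in `p`. Parameters of `R ⧸ p` are analytically independent; lift them and multiply by one
element of `J` outside `p`. Upper bound: an analytically independent sequence in `J` stays so modulo
some prime `q`. Its entries are nonzero there, so `J` is not in `q` and hence `0 : J^∞ ≤ q`. This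
reduces to a local domain, where kernels of partial Rees maps form a chain of primes below `𝔪R[x]`,
an ideal whose height is the dimension. -/

/-! ### Extended primes and homogeneous substitution -/

open MvPolynomial in
theorem Ideal.map_mvPolynomial_C_isPrime {R σ : Type*} [CommRing R] (p : Ideal R) [p.IsPrime] :
    (p.map (C : R →+* MvPolynomial σ R)).IsPrime := by
  have h := MvPolynomial.ker_map (σ := σ) (Ideal.Quotient.mk p)
  rw [Ideal.mk_ker] at h
  rw [← h]
  exact RingHom.ker_isPrime _

/-- Going-down makes heights additive along the fibre, and the extended prime is zero in its fibre.
-/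
theorem Ideal.height_map_mvPolynomial_C {R σ : Type*} [CommRing R] [IsNoetherianRing R] [Finite σ]
    (p : Ideal R) [p.IsPrime] :
    (p.map (MvPolynomial.C : R →+* MvPolynomial σ R)).height = p.height := by
  have hp : (p.map (MvPolynomial.C : R →+* MvPolynomial σ R)).IsPrime :=
    p.map_mvPolynomial_C_isPrime
  have : (p.map (MvPolynomial.C : R →+* MvPolynomial σ R)).LiesOver p := by
    refine ⟨?_⟩
    ext r
    rw [Ideal.under_def, Ideal.mem_comap, MvPolynomial.algebraMap_eq, MvPolynomial.mem_map_C_iff]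
    refine ⟨fun h e => ?_, fun h => by simpa using h 0⟩
    classical
    rw [MvPolynomial.coeff_C]
    split_ifs <;> simp [h]
  rw [Ideal.height_eq_height_add_of_liesOver_of_hasGoingDown p]
  have hn : Nontrivial (MvPolynomial σ R ⧸ p.map (algebraMap R (MvPolynomial σ R))) :=
    Ideal.Quotient.nontrivial_iff.mpr hp.ne_top
  have : (p.map (MvPolynomial.C : R →+* MvPolynomial σ R)).map
      (Ideal.Quotient.mk (p.map (algebraMap R (MvPolynomial σ R)))) = ⊥ := by
    rw [MvPolynomial.algebraMap_eq, Ideal.map_quotient_self]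
  rw [this, Ideal.height_bot, add_zero]

theorem MvPolynomial.IsHomogeneous.eval₂_const_mul {R S σ : Type*} [CommRing R] [CommRing S]
    {f : MvPolynomial σ R} {d : ℕ} (hf : f.IsHomogeneous d) (g : R →+* S) (c : S) (x : σ → S) :
    f.eval₂ g (fun i => c * x i) = c ^ d * f.eval₂ g x := by
  rw [eval₂_eq, eval₂_eq, Finset.mul_sum]
  refine Finset.sum_congr rfl fun e he => ?_
  rw [hf.degree_eq_sum_deg_support he, Finset.prod_congr rfl fun i _ => mul_pow c (x i) (e i),
    Finset.prod_mul_distrib, Finset.prod_pow_eq_pow_sum]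
  ring

/-- The variable `t` separates degrees, so vanishing under `xᵢ ↦ aᵢ t` is tested on each homogeneous
component. -/
theorem MvPolynomial.coeff_eval₂_C_mul_X {R A σ : Type*} [CommRing R] [CommRing A]
    (g : R →+* A) (a : σ → R) (f : MvPolynomial σ R) (n : ℕ) :
    (f.eval₂ (Polynomial.C.comp g) fun i => Polynomial.C (g (a i)) * Polynomial.X).coeff n =
      g (eval a (homogeneousComponent n f)) := by
  have hcomp (k : ℕ) : (homogeneousComponent k f).eval₂ (Polynomial.C.comp g)
      (fun i => Polynomial.C (g (a i)) * Polynomial.X) =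
        Polynomial.C (g (eval a (homogeneousComponent k f))) * Polynomial.X ^ k := by
    simp_rw [mul_comm _ Polynomial.X]
    rw [(homogeneousComponent_isHomogeneous k f).eval₂_const_mul, ← RingHom.comp_apply, eval,
      coe_eval₂Hom, hom_eval₂, mul_comm]
    rfl
  conv_lhs => rw [← sum_homogeneousComponent f]
  rw [eval₂_sum]
  simp_rw [hcomp, Polynomial.finsetSum_coeff, Polynomial.coeff_C_mul_X_pow]
  rw [Finset.sum_ite_eq]
  split_ifs with h
  · rfl
  · rw [homogeneousComponent_eq_zero _ _ (by simpa using h)]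
    simp

/-! ### Partial Rees maps and their kernels -/

section PartialReesMap

open MvPolynomial

variable {R : Type*} [CommRing R] {s : ℕ}

/-- The substitution `xᵢ ↦ aᵢ t` for `i < j` and `xᵢ ↦ xᵢ` for `i ≥ j`. -/
noncomputable def partialReesMap {s : ℕ} (a : Fin s → R) (j : ℕ) :
    MvPolynomial (Fin s) R →+* Polynomial (MvPolynomial (Fin s) R) :=
  eval₂Hom (Polynomial.C.comp C) fun i =>
    if (i : ℕ) < j then Polynomial.C (C (a i)) * Polynomial.X else Polynomial.C (X i)

theorem partialReesMap_C (a : Fin s → R) (j : ℕ) (r : R) :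
    partialReesMap a j (C r) = Polynomial.C (C r) :=
  eval₂Hom_C _ _ r

theorem partialReesMap_X_of_lt (a : Fin s → R) {j : ℕ} {i : Fin s} (h : (i : ℕ) < j) :
    partialReesMap a j (X i) = Polynomial.C (C (a i)) * Polynomial.X := by
  rw [partialReesMap, eval₂Hom_X', if_pos h]

theorem partialReesMap_X_of_le (a : Fin s → R) {j : ℕ} {i : Fin s} (h : j ≤ (i : ℕ)) :
    partialReesMap a j (X i) = Polynomial.C (X i) := by
  rw [partialReesMap, eval₂Hom_X', if_neg h.not_gt]

/-- Each map is the previous one followed by the substitution `xⱼ ↦ aⱼ t`. -/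
theorem ker_partialReesMap_le_succ (a : Fin s → R) (j : Fin s) :
    RingHom.ker (partialReesMap a j) ≤ RingHom.ker (partialReesMap a (j + 1)) := by
  let ρ : Polynomial (MvPolynomial (Fin s) R) →+* Polynomial (MvPolynomial (Fin s) R) :=
    Polynomial.eval₂RingHom (eval₂Hom (Polynomial.C.comp C) fun i =>
      if i = j then Polynomial.C (C (a j)) * Polynomial.X else Polynomial.C (X i)) Polynomial.X
  have h : partialReesMap a (j + 1) = ρ.comp (partialReesMap a j) := by
    refine MvPolynomial.ringHom_ext (fun r => by simp [partialReesMap_C, ρ]) fun i => ?_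
    rw [RingHom.comp_apply]
    rcases lt_trichotomy i j with hij | rfl | hij
    · have h1 : (i : ℕ) < j := hij
      rw [partialReesMap_X_of_lt a h1, partialReesMap_X_of_lt a (h1.trans (Nat.lt_succ_self _))]
      simp [ρ]
    · rw [partialReesMap_X_of_lt a (Nat.lt_succ_self _), partialReesMap_X_of_le a le_rfl]
      simp [ρ]
    · have h1 : (j : ℕ) < i := hij
      rw [partialReesMap_X_of_le a h1.le, partialReesMap_X_of_le a h1]
      simp [ρ, hij.ne']
  intro f hf
  rw [RingHom.mem_ker] at hf ⊢
  rw [h, RingHom.comp_apply, hf, map_zero]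

/-- The relation `a₀ xⱼ - aⱼ x₀` separates the kernels: before `xⱼ` is replaced, its image has
constant term `a₀ xⱼ` in `t`. -/
theorem ker_partialReesMap_lt_succ [IsDomain R] {a : Fin (s + 1) → R} (ha : a 0 ≠ 0)
    {j : Fin (s + 1)} (hj : 0 < j) :
    RingHom.ker (partialReesMap a j) < RingHom.ker (partialReesMap a (j + 1)) := by
  refine lt_of_le_of_ne (ker_partialReesMap_le_succ a j) fun h => ?_
  have hj' : 0 < (j : ℕ) := hj
  have h1 : C (a 0) * X j - C (a j) * X 0 ∈ RingHom.ker (partialReesMap a (j + 1)) := by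
    rw [RingHom.mem_ker, map_sub, map_mul, map_mul, partialReesMap_C, partialReesMap_C,
      partialReesMap_X_of_lt a (Nat.lt_succ_self _), partialReesMap_X_of_lt a (Nat.succ_pos _)]
    ring
  rw [← h, RingHom.mem_ker, map_sub, map_mul, map_mul, partialReesMap_C, partialReesMap_C,
    partialReesMap_X_of_le a le_rfl, partialReesMap_X_of_lt a hj'] at h1
  simpa [ha] using congrArg (fun p => Polynomial.coeff p 0) h1

end PartialReesMap

/-! ### Analytically independent sequences -/

namespace AnalyticallyIndependent

open IsLocalRing MvPolynomial

variable {R : Type*} [CommRing R] [IsLocalRing R] {s : ℕ} {a : Fin s → R}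

theorem mem_map_C (ha : AnalyticallyIndependent a) {d : ℕ} {f : MvPolynomial (Fin s) R}
    (hf : f.IsHomogeneous d) (h : eval a f = 0) :
    f ∈ (maximalIdeal R).map (C : R →+* MvPolynomial (Fin s) R) :=
  mem_map_C_iff.mpr (ha.2 d f hf h)

theorem pow_ne_zero (ha : AnalyticallyIndependent a) (i : Fin s) (n : ℕ) : a i ^ n ≠ 0 := by
  intro h
  have := ha.2 n (X i ^ n) (isHomogeneous_X_pow i n) (by simpa using h) (Finsupp.single i n)
  rw [X_pow_eq_monomial, coeff_monomial, if_pos rfl] at this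
  exact (Ideal.ne_top_iff_one _).mp (maximalIdeal.isMaximal R).ne_top this

theorem ne_zero (ha : AnalyticallyIndependent a) (i : Fin s) : a i ≠ 0 := by
  simpa using ha.pow_ne_zero i 1

theorem of_isEmpty (a : Fin 0 → R) : AnalyticallyIndependent a := by
  refine ⟨fun i => i.elim0, fun d f _ h e => ?_⟩
  rw [eq_C_of_isEmpty f, eval_C] at h
  rw [Subsingleton.elim e 0, h]
  exact zero_mem _

/-- If `D` is a domain, multiplying a sequence by an element that is nonzero in `D` does not
affect analytic independence in `D`. -/
theorem const_mul_of_map {D : Type*} [CommRing D] [IsDomain D] [IsLocalRing D] (φ : R →+* D)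
    [IsLocalHom φ] {r : Fin s → R} (hr : AnalyticallyIndependent fun i => φ (r i)) {c : R}
    (hc : φ c ≠ 0) : AnalyticallyIndependent fun i => c * r i := by
  have hm {x : R} (hx : φ x ∈ maximalIdeal D) : x ∈ maximalIdeal R :=
    (mem_maximalIdeal x).mpr fun h => (mem_maximalIdeal _).mp hx (h.map φ)
  refine ⟨fun i => Ideal.mul_mem_left _ _ (hm (hr.1 i)), fun d f hf h e => hm ?_⟩
  rw [← coeff_map]
  refine hr.2 d _ (hf.map φ) ?_ e
  have h1 := congrArg φ h
  rw [eval, coe_eval₂Hom, hf.eval₂_const_mul, map_mul, map_pow, map_zero, hom_eval₂] at h1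
  rw [eval_map]
  exact (mul_eq_zero.mp h1).resolve_left (_root_.pow_ne_zero d hc)

/-- Parameters work. If a form `f` outside `𝔪R[x]` vanished at `b`, then `𝔪R[x]`, of height `n`,
would be minimal over the `n - 1` elements `b₀ xᵢ - bᵢ x₀`, against Krull's height theorem. -/
theorem exists_of_ringKrullDim_eq [IsNoetherianRing R] {n : ℕ} (hn : ringKrullDim R = n) :
    ∃ b : Fin n → R, AnalyticallyIndependent b := by
  obtain ⟨t, ht, hcard⟩ := (maximalIdeal R).exists_finset_card_eq_height_of_isNoetherianRing
  have hdim : (maximalIdeal R).height = n := by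
    rw [← maximalIdeal_height_eq_ringKrullDim] at hn
    exact_mod_cast hn
  have htn : t.card = n := by rw [hdim] at hcard; exact_mod_cast hcard
  let b : Fin n → R := fun i => (t.equivFinOfCardEq htn).symm i
  have hb (x : R) (hx : x ∈ t) : ∃ i, b i = x :=
    ⟨t.equivFinOfCardEq htn ⟨x, hx⟩, by simp [b]⟩
  have hbm (i : Fin n) : b i ∈ maximalIdeal R :=
    ht.1.2 (Ideal.subset_span ((t.equivFinOfCardEq htn).symm i).2)
  refine ⟨b, ?_⟩
  clear_value b
  obtain _ | k := n
  · exact of_isEmpty b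
  refine ⟨hbm, fun d f hf h => mem_map_C_iff.mp ?_⟩
  by_contra hfm
  let M := (maximalIdeal R).map (C : R →+* MvPolynomial (Fin (k + 1)) R)
  have hM : M.IsPrime := Ideal.map_mvPolynomial_C_isPrime _
  have hXM : (X 0 : MvPolynomial (Fin (k + 1)) R) ∉ M := by
    intro hX
    have := mem_map_C_iff.mp hX (Finsupp.single 0 1)
    rw [coeff_X, if_pos rfl] at this
    exact (Ideal.ne_top_iff_one _).mp (maximalIdeal.isMaximal R).ne_top this
  classical
  let y : Finset (MvPolynomial (Fin (k + 1)) R) :=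
    Finset.univ.image fun i : Fin k => C (b 0) * X i.succ - C (b i.succ) * X 0
  have hyM : Ideal.span (y : Set (MvPolynomial (Fin (k + 1)) R)) ≤ M := by
    rw [Ideal.span_le]
    intro z hz
    obtain ⟨i, -, rfl⟩ := Finset.mem_image.mp hz
    exact sub_mem (Ideal.mul_mem_right _ _ (Ideal.mem_map_of_mem _ (hbm _)))
      (Ideal.mul_mem_right _ _ (Ideal.mem_map_of_mem _ (hbm _)))
  have hmin : M ∈ (Ideal.span (y : Set (MvPolynomial (Fin (k + 1)) R))).minimalPrimes := by
    refine ⟨⟨hM, hyM⟩, fun Q ⟨hQ, hyQ⟩ hQM => ?_⟩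
    have hQeq (i : Fin (k + 1)) : Ideal.Quotient.mk Q (C (b 0)) * Ideal.Quotient.mk Q (X i) =
        Ideal.Quotient.mk Q (X 0) * Ideal.Quotient.mk Q (C (b i)) := by
      refine Fin.cases (mul_comm _ _) (fun i => ?_) i
      rw [← map_mul, ← map_mul, Ideal.Quotient.eq, mul_comm (X 0)]
      exact hyQ (Ideal.subset_span (Finset.mem_image.mpr ⟨i, Finset.mem_univ _, rfl⟩))
    have hb0 : C (b 0) ∈ Q := by
      -- Modulo `Q`, homogeneity gives `b₀ᵈ f(x) = f(b₀ x) = f(x₀ b) = x₀ᵈ f(b) = 0`.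
      have h1 : C (b 0) ^ d * f ∈ Q := by
        rw [← Ideal.Quotient.eq_zero_iff_mem, map_mul, map_pow]
        have hf2 : Ideal.Quotient.mk Q f = f.eval₂ ((Ideal.Quotient.mk Q).comp C)
            fun i => Ideal.Quotient.mk Q (X i) := by
          conv_lhs => rw [← eval₂_eta f]
          rw [hom_eval₂]
        rw [hf2, ← hf.eval₂_const_mul]
        simp_rw [hQeq]
        rw [hf.eval₂_const_mul]
        have h0 := congrArg ((Ideal.Quotient.mk Q).comp C) h
        rw [eval, coe_eval₂Hom, hom_eval₂, map_zero] at h0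
        rw [RingHom.comp_id] at h0
        erw [h0]
        exact mul_zero _
      exact hQ.mem_of_pow_mem d ((hQ.mem_or_mem h1).resolve_right fun hfQ => hfm (hQM hfQ))
    have hbQ (i : Fin (k + 1)) : C (b i) ∈ Q := by
      have h1 := hQeq i
      rw [Ideal.Quotient.eq_zero_iff_mem.mpr hb0, zero_mul, ← map_mul, eq_comm,
        Ideal.Quotient.eq_zero_iff_mem] at h1
      exact (hQ.mem_or_mem h1).resolve_left fun hX => hXM (hQM hX)
    have hcomap : (Q.comap C).IsPrime := Ideal.comap_isPrime _ _
    refine Ideal.map_le_iff_le_comap.mpr (ht.2 ⟨hcomap, ?_⟩ (le_maximalIdeal hcomap.ne_top))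
    rw [Ideal.span_le]
    intro x hx
    obtain ⟨i, rfl⟩ := hb x hx
    exact hbQ i
  have hle := Ideal.height_le_card_of_mem_minimalPrimes_span_finset hmin
  rw [Ideal.height_map_mvPolynomial_C, hdim, Nat.cast_le] at hle
  have := hle.trans (Finset.card_image_le.trans_eq (Finset.card_fin k))
  omega

/-- In a domain the number of analytically independent elements is at most the dimension. -/
theorem le_ringKrullDim_of_isDomain [IsNoetherianRing R] [IsDomain R]
    (ha : AnalyticallyIndependent a) : (s : WithBot ℕ∞) ≤ ringKrullDim R := by
  obtain _ | s := s
  · simpa using ringKrullDim_nonneg_of_nontrivial (R := R)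
  have hprime (j : ℕ) : (RingHom.ker (partialReesMap a j)).IsPrime := RingHom.ker_isPrime _
  -- The chain starts at index 1, since replacing `x₀` alone need not enlarge the kernel; the final
  -- inclusion into `𝔪R[x]` supplies the missing unit of height.
  have hchain (j : ℕ) (hj : j ≤ s) :
      (j : ℕ∞) ≤ (RingHom.ker (partialReesMap a (j + 1))).height := by
    induction j with
    | zero => simp
    | succ j ih =>
      have := hprime (j + 1)
      have := hprime (j + 1 + 1)
      have hlt := ker_partialReesMap_lt_succ (ha.ne_zero 0)
        (j := (⟨j + 1, by omega⟩ : Fin (s + 1))) (Fin.mk_lt_mk.mpr (Nat.succ_pos j))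
      push_cast
      exact (add_le_add_left (ih (by omega)) 1).trans
        (Ideal.height_add_one_le_of_lt_of_isPrime hlt)
  have hM : ((maximalIdeal R).map (C : R →+* MvPolynomial (Fin (s + 1)) R)).IsPrime :=
    Ideal.map_mvPolynomial_C_isPrime _
  have hlt : RingHom.ker (partialReesMap a (s + 1)) <
      (maximalIdeal R).map (C : R →+* MvPolynomial (Fin (s + 1)) R) := by
    refine lt_of_le_of_ne (fun f hf => mem_map_C_iff.mpr fun e => ?_) fun h => ?_
    · have h1 := coeff_eval₂_C_mul_X (C : R →+* MvPolynomial (Fin (s + 1)) R) a f e.degree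
      have h2 : f.eval₂ (Polynomial.C.comp C)
          (fun i => Polynomial.C (C (σ := Fin (s + 1)) (a i)) * Polynomial.X) = 0 := by
        rw [RingHom.mem_ker, partialReesMap, coe_eval₂Hom] at hf
        simpa only [Fin.is_lt, if_true] using hf
      rw [h2, Polynomial.coeff_zero, eq_comm, C_eq_zero] at h1
      have h3 := ha.2 _ _ (homogeneousComponent_isHomogeneous _ f) h1 e
      rwa [coeff_homogeneousComponent, if_pos rfl] at h3
    · have h1 : C (a 0) ∈ RingHom.ker (partialReesMap a (s + 1)) :=
        h ▸ Ideal.mem_map_of_mem _ (ha.1 0)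
      rw [RingHom.mem_ker] at h1
      simp [partialReesMap_C, ha.ne_zero 0] at h1
  have := hprime (s + 1)
  have h1 := (add_le_add_left (hchain s le_rfl) 1).trans
    (Ideal.height_add_one_le_of_lt_of_isPrime hlt)
  rw [Ideal.height_map_mvPolynomial_C] at h1
  rw [← maximalIdeal_height_eq_ringKrullDim]
  exact_mod_cast h1

/-- Analytic independence is preserved modulo some prime ideal. -/
theorem exists_isPrime_forall_quotient [IsNoetherianRing R] (ha : AnalyticallyIndependent a) :
    ∃ p : Ideal R, p.IsPrime ∧ ∀ (d : ℕ) (f : MvPolynomial (Fin s) R), f.IsHomogeneous d →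
      eval a f ∈ p → ∀ e, f.coeff e ∈ maximalIdeal R := by
  by_contra! H
  have hM : ((maximalIdeal R).map (C : R →+* MvPolynomial (Fin s) R)).IsPrime :=
    Ideal.map_mvPolynomial_C_isPrime _
  -- If every minimal prime fails, the product of the bad forms has nilpotent value at `a`, so a
  -- power of it lies in the prime `𝔪R[x]`, and then so does one of the forms.
  choose d f hf hfp e he using fun p : minimalPrimes R => H p.1 (Ideal.IsMinimalPrime.isPrime p.2)
  have : Fintype (minimalPrimes R) := (minimalPrimes.finite_of_isNoetherianRing R).fintype
  have hnil : eval a (∏ p, f p) ∈ nilradical R := by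
    rw [nilradical, ← Ideal.sInf_minimalPrimes, Submodule.mem_sInf]
    intro p hp
    rw [map_prod]
    exact Ideal.mem_of_dvd _ (Finset.dvd_prod_of_mem _ (Finset.mem_univ ⟨p, hp⟩)) (hfp ⟨p, hp⟩)
  obtain ⟨n, hn⟩ := mem_nilradical.mp hnil
  rw [← map_pow] at hn
  have h1 := ha.mem_map_C ((IsHomogeneous.prod Finset.univ f d fun p _ => hf p).pow n) hn
  obtain ⟨p, -, hp⟩ := (hM.prod_mem_iff).mp (hM.mem_of_pow_mem n h1)
  exact he p (mem_map_C_iff.mp hp (e p))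

theorem map_of_forall {D : Type*} [CommRing D] [IsLocalRing D] (φ : R →+* D)
    (hφ : Function.Surjective φ) (ha : ∀ i, a i ∈ maximalIdeal R)
    (h : ∀ (d : ℕ) (f : MvPolynomial (Fin s) R), f.IsHomogeneous d →
      φ (eval a f) = 0 → ∀ e, f.coeff e ∈ maximalIdeal R) :
    AnalyticallyIndependent fun i => φ (a i) := by
  have : IsLocalHom φ := .of_surjective φ hφ
  have hm {x : R} (hx : x ∈ maximalIdeal R) : φ x ∈ maximalIdeal D :=
    (mem_maximalIdeal _).mpr fun hu => (mem_maximalIdeal x).mp hx (isUnit_of_map_unit φ x hu)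
  refine ⟨fun i => hm (ha i), fun d g hg hg0 e => ?_⟩
  obtain ⟨f, rfl⟩ := MvPolynomial.map_surjective φ hφ g
  -- A lift of a form need not be homogeneous, but its degree `d` component is again a lift.
  have hfd : map φ (homogeneousComponent d f) = map φ f := by
    ext e
    rw [coeff_map, coeff_homogeneousComponent, coeff_map]
    split_ifs with hd
    · rfl
    · rw [map_zero, ← coeff_map, hg.coeff_eq_zero hd]
  rw [← hfd] at hg0 ⊢
  rw [coeff_map]
  refine hm (h d _ (homogeneousComponent_isHomogeneous d f) ?_ e)
  rw [← hg0, eval_map, eval, coe_eval₂Hom, hom_eval₂]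
  rfl

end AnalyticallyIndependent

/-! ### Saturation and its minimal primes -/

section Saturation

open IsLocalRing

variable {R : Type*} [CommRing R]

theorem zeroSaturation_eq_top_iff (J : Ideal R) : zeroSaturation J = ⊤ ↔ IsNilpotent J := by
  rw [Ideal.eq_top_iff_one, mem_zeroSaturation]
  refine exists_congr fun m => ?_
  simp [Submodule.eq_bot_iff]

theorem zeroSaturation_le_of_isPrime {J p : Ideal R} [hp : p.IsPrime] (h : ¬ J ≤ p) :
    zeroSaturation J ≤ p := by
  intro r hr
  obtain ⟨m, hm⟩ := (mem_zeroSaturation J r).mp hr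
  obtain ⟨x, hxJ, hxp⟩ := SetLike.not_le_iff_exists.mp h
  refine (hp.mem_or_mem ((hm _ (Ideal.pow_mem_pow hxJ m)) ▸ p.zero_mem)).resolve_right fun h => ?_
  exact hxp (hp.mem_of_pow_mem m h)

theorem exists_zeroSaturation_eq_colon [IsNoetherianRing R] (J : Ideal R) :
    ∃ m : ℕ, zeroSaturation J = (⊥ : Ideal R).colon ((J ^ m : Ideal R) : Set R) := by
  obtain ⟨m, hm⟩ := monotone_stabilizes_iff_noetherian.mpr ‹IsNoetherianRing R›
    ⟨fun m => (⊥ : Ideal R).colon ((J ^ m : Ideal R) : Set R),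
      fun _ _ h => Submodule.colon_mono le_rfl (Ideal.pow_le_pow_right h)⟩
  refine ⟨m, le_antisymm (iSup_le fun k => ?_) (le_iSup
    (fun m : ℕ => (⊥ : Ideal R).colon ((J ^ m : Ideal R) : Set R)) m)⟩
  obtain hk | hk := le_total m k
  · exact (hm k hk).ge
  · exact Submodule.colon_mono le_rfl (Ideal.pow_le_pow_right hk)

/-- By the Noetherian property one power `J ^ m` kills the whole saturation, so `J ^ (m + 1)` kills
`y`. -/
theorem mem_zeroSaturation_of_forall_mul_mem [IsNoetherianRing R] {J : Ideal R} {y : R}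
    (h : ∀ x ∈ J, x * y ∈ zeroSaturation J) : y ∈ zeroSaturation J := by
  obtain ⟨m, hm⟩ := exists_zeroSaturation_eq_colon J
  refine (mem_zeroSaturation J y).mpr ⟨m + 1, fun z hz => ?_⟩
  rw [pow_succ'] at hz
  refine Submodule.mul_induction_on hz (fun x hx w hw => ?_) fun u v hu hv => by
    rw [mul_add, hu, hv, add_zero]
  have h1 := h x hx
  rw [hm, Submodule.mem_colon] at h1
  have h2 := h1 w hw
  rw [Submodule.mem_bot, smul_eq_mul] at h2
  rw [← h2]
  ring

/-- Such a prime is the annihilator of some `y` modulo the saturation; if it contained `J`, then `y`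
would itself lie in the saturation. -/
theorem not_le_of_mem_minimalPrimes_zeroSaturation [IsNoetherianRing R] {J p : Ideal R}
    (hp : p ∈ (zeroSaturation J).minimalPrimes) : ¬ J ≤ p := by
  intro hJ
  have hp' : p ∈ ((zeroSaturation J).colon {(1 : R)}).minimalPrimes := by
    convert hp using 2
    ext x
    simp [Submodule.mem_colon]
  obtain ⟨y, rfl⟩ := Submodule.exists_eq_colon_of_mem_minimalPrimes hp'
  have hy : y ∈ zeroSaturation J :=
    mem_zeroSaturation_of_forall_mul_mem fun x hx => by
      simpa [Submodule.mem_colon] using hJ hx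
  refine hp.1.1.ne_top ((Ideal.eq_top_iff_one _).mpr ?_)
  simpa [Submodule.mem_colon] using hy

/-- A longest chain of primes over `I` lies entirely over any minimal prime below its first term. -/
theorem Ideal.exists_minimalPrimes_ringKrullDim_quotient_eq [IsNoetherianRing R] [IsLocalRing R]
    {I : Ideal R} (hI : I ≠ ⊤) :
    ∃ p ∈ I.minimalPrimes, ringKrullDim (R ⧸ p) = ringKrullDim (R ⧸ I) := by
  have : Nontrivial (R ⧸ I) := Ideal.Quotient.nontrivial_iff.mpr hI
  have : IsLocalRing (R ⧸ I) := .of_surjective' _ Ideal.Quotient.mk_surjective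
  obtain ⟨l, hl, hlen⟩ := (maximalIdeal (R ⧸ I)).exists_ltSeries_length_eq_height
  let q := l.head.asIdeal.comap (Ideal.Quotient.mk I)
  have hIq : I ≤ q := fun x hx => by
    rw [Ideal.mem_comap, Ideal.Quotient.eq_zero_iff_mem.mpr hx]
    exact zero_mem _
  obtain ⟨p, hp, hpq⟩ := Ideal.exists_minimalPrimes_le hIq
  refine ⟨p, hp, le_antisymm (ringKrullDim_le_of_surjective (Ideal.Quotient.factor hp.1.2)
    (Ideal.Quotient.factor_surjective hp.1.2)) ?_⟩
  rw [← maximalIdeal_height_eq_ringKrullDim, ← hlen, ringKrullDim_quotient]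
  have hmem (i : Fin (l.length + 1)) :
      PrimeSpectrum.comap (Ideal.Quotient.mk I) (l i) ∈ PrimeSpectrum.zeroLocus (p : Set R) :=
    fun x hx => (l.monotone (Fin.zero_le i) : l.head ≤ l i) (hpq hx)
  let l' : LTSeries (PrimeSpectrum.zeroLocus (p : Set R)) :=
    { length := l.length
      toFun := fun i => ⟨_, hmem i⟩
      step := fun i => RingHom.strictMono_comap_of_surjective Ideal.Quotient.mk_surjective
        (l.step i) }
  exact Order.LTSeries.length_le_krullDim l'

end Saturation

/-! ### The main theorem -/

theorem corollary1p10 {R : Type*} [CommRing R] [IsNoetherianRing R] [IsLocalRing R]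
    (J : Ideal R) :
    ∃ n : ℕ,
      IsGreatest {s : ℕ | ∃ a : Fin s → R, (∀ i, a i ∈ J) ∧ AnalyticallyIndependent a} n ∧
      (¬ IsNilpotent J → ringKrullDim (R ⧸ zeroSaturation J) = n) ∧
      (IsNilpotent J → zeroSaturation J = ⊤ ∧ n = 0) := by
  classical
  by_cases hJ : IsNilpotent J
  · refine ⟨0, ⟨⟨Fin.elim0, fun i => i.elim0, .of_isEmpty _⟩, ?_⟩, fun h => absurd hJ h,
      fun _ => ⟨(zeroSaturation_eq_top_iff J).mpr hJ, rfl⟩⟩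
    rintro s ⟨a, haJ, ha⟩
    by_contra hs
    obtain ⟨m, hm⟩ := hJ
    refine ha.pow_ne_zero ⟨0, by omega⟩ m ?_
    have h1 := Ideal.pow_mem_pow (haJ ⟨0, by omega⟩) m
    rwa [hm] at h1
  have hI : zeroSaturation J ≠ ⊤ := fun h => hJ ((zeroSaturation_eq_top_iff J).mp h)
  obtain ⟨p, hp, hdim⟩ := Ideal.exists_minimalPrimes_ringKrullDim_quotient_eq hI
  have hJp := not_le_of_mem_minimalPrimes_zeroSaturation hp
  have hpp : p.IsPrime := hp.1.1
  have : IsLocalRing (R ⧸ p) := .of_surjective' _ Ideal.Quotient.mk_surjective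
  have : IsLocalHom (Ideal.Quotient.mk p) := .of_surjective _ Ideal.Quotient.mk_surjective
  obtain ⟨n, hn⟩ : ∃ n : ℕ, ringKrullDim (R ⧸ p) = n := by
    have h1 := Ideal.height_ne_top_of_isPrime (I := IsLocalRing.maximalIdeal (R ⧸ p))
    obtain ⟨n, hn⟩ := ENat.ne_top_iff_exists.mp h1
    exact ⟨n, by rw [← IsLocalRing.maximalIdeal_height_eq_ringKrullDim, ← hn]; rfl⟩
  refine ⟨n, ⟨?_, ?_⟩, fun _ => hdim ▸ hn, fun h => absurd h hJ⟩
  · obtain ⟨b, hb⟩ := AnalyticallyIndependent.exists_of_ringKrullDim_eq hn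
    choose r hr using fun i => Ideal.Quotient.mk_surjective (b i)
    obtain ⟨c, hcJ, hcp⟩ := SetLike.not_le_iff_exists.mp hJp
    refine ⟨fun i => c * r i, fun i => J.mul_mem_right _ hcJ,
      AnalyticallyIndependent.const_mul_of_map (Ideal.Quotient.mk p) ?_ ?_⟩
    · simpa only [hr] using hb
    · rwa [Ne, Ideal.Quotient.eq_zero_iff_mem]
  · rintro s ⟨a, haJ, ha⟩
    obtain _ | s := s
    · exact Nat.zero_le n
    obtain ⟨q, hq, h⟩ := ha.exists_isPrime_forall_quotient
    have : IsLocalRing (R ⧸ q) := .of_surjective' _ Ideal.Quotient.mk_surjective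
    have hind : AnalyticallyIndependent fun i => Ideal.Quotient.mk q (a i) :=
      .map_of_forall _ Ideal.Quotient.mk_surjective ha.1 fun d f hf h0 =>
        h d f hf (Ideal.Quotient.eq_zero_iff_mem.mp h0)
    have hJq : ¬ J ≤ q := fun hle =>
      hind.ne_zero 0 (Ideal.Quotient.eq_zero_iff_mem.mpr (hle (haJ 0)))
    have hle := zeroSaturation_le_of_isPrime hJq
    have h1 := hind.le_ringKrullDim_of_isDomain.trans (ringKrullDim_le_of_surjective
      (Ideal.Quotient.factor hle) (Ideal.Quotient.factor_surjective hle))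
    rw [← hdim, hn] at h1
    exact_mod_cast h1
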